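/- Let $\mathbb F_q$ be a finite field with $q$ elements and characteristic $p$, and let $\varphi(x)=\exp\bigl(2\pi i\,\mathrm{Tr}_{\mathbb F_q/\mathbb F_p}(x)/p\bigr)$ be its standard additive character. For $\alpha\in\mathbb F_q$ and $a\in M_n(\mathbb F_q)$ put \[ K_1(\alpha)=\sum_{x\in\mathbb F_q^*}\varphi(\alpha x+x^{-1}),\qquad K_n(a)=\sum_{x\in \mathrm{GL}_n(\mathbb F_q)}\varphi\bigl(\mathrm{tr}(ax+x^{-1})\bigr). \] Theorem. Let $n\geq 1$ be an integer and let $\lambda$ be a partition of $n$. There exists a polynomial $P_\lambda(A,G,K)\in\mathbb Z[A,G,K]$, depending only on $\lambda$ (in particular neither on $q$ nor on the characteristic), such that for every finite field $\mathbb F_q$ and every $a\in\mathrm{GL}_n(\mathbb F_q)$ which has a unique eigenvalue $\alpha$ in an algebraic closure of $\mathbb F_q$, with $\alpha\in\mathbb F_q$, $\alpha\neq0$, and for which $\lambda$ is the partition of $n$ formed by the sizes of the blocks in the Jordan normal form of $a$, \[ K_n(a)=P_\lambda\bigl(q,\;q-1,\;K_1(\alpha)\bigr). \] -/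

import Mathlib

/-- The standard additive character `φ` of a finite field `F` of characteristic `p`: the trace from
`F` to its prime field `ZMod p`, followed by `j ↦ exp (2 π i j / p)`. -/
noncomputable def stdChar (p : ℕ) [Fact p.Prime] (F : Type*) [Field F] [Algebra (ZMod p) F] (x : F) :
    ℂ :=
  ZMod.stdAddChar (Algebra.trace (ZMod p) F x)

/-- The classical Kloosterman sum `K₁(α) = ∑_{x ∈ Fˣ} φ(α x + x⁻¹)`. -/
noncomputable def kloosterman (p : ℕ) [Fact p.Prime] {F : Type*} [Field F] [Fintype F]
    [DecidableEq F] [Algebra (ZMod p) F] (α : F) : ℂ :=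
  ∑ x : Fˣ, stdChar p F (α * (x : F) + ((x⁻¹ : Fˣ) : F))

/-- The matrix Kloosterman sum `K_n(a) = ∑_{x ∈ GL_n(F)} φ(tr (a x + x⁻¹))`. -/
noncomputable def matrixKloosterman (p : ℕ) [Fact p.Prime] {F : Type*} [Field F] [Fintype F]
    [DecidableEq F] [Algebra (ZMod p) F] {n : ℕ} (a : Matrix (Fin n) (Fin n) F) : ℂ :=
  ∑ x : Matrix.GeneralLinearGroup (Fin n) F,
    stdChar p F (Matrix.trace (a * (x : Matrix (Fin n) (Fin n) F) +
      ((x⁻¹ : Matrix.GeneralLinearGroup (Fin n) F) : Matrix (Fin n) (Fin n) F)))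

/-- `α ∈ F` is an eigenvalue of `a`, and it is the only one in an algebraic closure of `F`. -/
def HasUniqueEigenvalue {F : Type*} [Field F] {n : ℕ} (a : Matrix (Fin n) (Fin n) F) (α : F) :
    Prop :=
  ∀ β : AlgebraicClosure F,
    Module.End.HasEigenvalue
        (Matrix.toLin' (a.map (algebraMap F (AlgebraicClosure F)))) β ↔
      β = algebraMap F (AlgebraicClosure F) α

/-- The Jordan block of size `m` with eigenvalue `β`: `β` on the diagonal, `1` directly above it. -/
def jordanBlock {F : Type*} [Field F] (m : ℕ) (β : F) : Matrix (Fin m) (Fin m) F :=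
  Matrix.of fun i j => if i = j then β else if (i : ℕ) + 1 = (j : ℕ) then 1 else 0

/-- `a` has a Jordan normal form over `F` (blocks with arbitrary eigenvalues `β i` in `F`), and the
block sizes `d i`, counted with multiplicity, are the parts of the partition `lam` of `n`. -/
def HasJordanPartition {F : Type*} [Field F] {n : ℕ} (a : Matrix (Fin n) (Fin n) F)
    (lam : Nat.Partition n) : Prop :=
  ∃ (r : ℕ) (d : Fin r → ℕ) (β : Fin r → F) (e : (Σ i : Fin r, Fin (d i)) ≃ Fin n)
    (g : Matrix.GeneralLinearGroup (Fin n) F),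
    Multiset.map d Finset.univ.val = lam.parts ∧
    (g : Matrix (Fin n) (Fin n) F) * a *
        ((g⁻¹ : Matrix.GeneralLinearGroup (Fin n) F) : Matrix (Fin n) (Fin n) F) =
      Matrix.reindex e e (Matrix.blockDiagonal' fun i => jordanBlock (d i) (β i))

/-! Let `N = a - α`, and let `e ≠ 0` lie in the last nonzero image `N^m V`, so that `a e = α e`.
Multiplying `x` on both sides by transvections with centre `e` changes its summand by an additive
character of the parameters. Hence only those `x` survive for which `α x e`, `a x e` and `x⁻¹ e`
agree modulo `e` (`endKloosterman_eq_sum_filter`). Put `w = x e`. If `w` is a multiple of `e`, then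
`x` stabilizes the line through `e`, and these `x` contribute `q^(n-1) K₁(α)` times the sum for
`V/e`. Otherwise the image of `w` in `V/e` is an eigenvector, `x` stabilizes the plane spanned by
`e` and `w`, and one gets the sum for the quotient by this plane, weighted by `ψ(t)` with `a w = α w
+ t e` (`endKloosterman_rec`).

By induction the sum for the quotient depends only on the ranks of the powers of the induced
nilpotent map, hence only on the depth of the image of `w` in the images of the powers of the map
induced by `N` on `V/e`. Summing `ψ(t)` over vectors of given depth reduces to character sums over
subspaces, each zero or a power of `q`; since `e` is as deep as possible, the exponents are read off
from the ranks of the `N^i`. This gives a universal polynomial in `q` and `K₁(α)`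
(`exists_polynomial_endKloosterman`). Finally, the Jordan type determines these ranks
(`rank_sub_algebraMap_pow`). -/

/-! ### Kloosterman sums of endomorphisms and block triangular automorphisms. -/

/-- The Kloosterman sum of an endomorphism `a` of a finite vector space `V`, with respect to an
additive character `ψ` of the ground field. -/
noncomputable def endKloosterman {F V : Type*} [Field F] [AddCommGroup V] [Module F V]
    (ψ : AddChar F ℂ) (a : Module.End F V) : ℂ :=
  ∑ᶠ x : (Module.End F V)ˣ, ψ (LinearMap.trace F V (a * x + (x⁻¹ : (Module.End F V)ˣ)))

theorem endKloosterman_eq_sum {F V : Type*} [Field F] [AddCommGroup V] [Module F V]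
    (ψ : AddChar F ℂ) (a : Module.End F V) [Fintype (Module.End F V)ˣ] :
    endKloosterman ψ a =
      ∑ x : (Module.End F V)ˣ, ψ (LinearMap.trace F V (a * x + (x⁻¹ : (Module.End F V)ˣ))) :=
  finsum_eq_sum_of_fintype _

theorem exists_splitting {F U V W : Type*} [Field F] [AddCommGroup U] [Module F U]
    [AddCommGroup V] [Module F V] [AddCommGroup W] [Module F W]
    (i : U →ₗ[F] V) (π : V →ₗ[F] W) (hi : Function.Injective i) (hπ : Function.Surjective π)
    (hex : LinearMap.range i = LinearMap.ker π) :
    ∃ (ρ : V →ₗ[F] U) (σ : W →ₗ[F] V), (∀ u, ρ (i u) = u) ∧ (∀ w, π (σ w) = w) ∧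
      (∀ u, π (i u) = 0) ∧ (∀ w, ρ (σ w) = 0) ∧ ∀ v, i (ρ v) + σ (π v) = v := by
  obtain ⟨ρ, hρ⟩ := LinearMap.exists_leftInverse_of_injective i (LinearMap.ker_eq_bot.2 hi)
  obtain ⟨σ, hσ⟩ := LinearMap.exists_rightInverse_of_surjective π (LinearMap.range_eq_top.2 hπ)
  have hρ' : ∀ u, ρ (i u) = u := fun u => LinearMap.congr_fun hρ u
  have hσ' : ∀ w, π (σ w) = w := fun w => LinearMap.congr_fun hσ w
  have hz : ∀ u, π (i u) = 0 := fun u => by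
    have : i u ∈ LinearMap.ker π := hex ▸ LinearMap.mem_range_self i u
    simpa using this
  -- An arbitrary section is corrected by its `U`-component, so that its image lies in the kernel of
  -- `ρ`.
  refine ⟨ρ, σ - i ∘ₗ ρ ∘ₗ σ, hρ', fun w => by simp [hσ', hz], hz, fun w => by simp [hρ'], ?_⟩
  intro v
  have hv : v - σ (π v) ∈ LinearMap.range i := by rw [hex]; simp [hσ']
  obtain ⟨u, hu⟩ := hv
  have hv : v = i u + σ (π v) := by rw [hu]; abel
  have h2 : ρ v = u + ρ (σ (π v)) := by conv_lhs => rw [hv]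
                                        rw [map_add, hρ']
  simp only [LinearMap.sub_apply, LinearMap.comp_apply, h2, map_add]
  conv_rhs => rw [hv]
  abel

theorem units_end_apply_inv {F V : Type*} [Field F] [AddCommGroup V] [Module F V]
    (x : (Module.End F V)ˣ) (v : V) :
    (x : Module.End F V) (((x⁻¹ : (Module.End F V)ˣ) : Module.End F V) v) = v := by
  rw [← Module.End.mul_apply, Units.mul_inv, Module.End.one_apply]

theorem units_end_inv_apply {F V : Type*} [Field F] [AddCommGroup V] [Module F V]
    (x : (Module.End F V)ˣ) (v : V) :
    ((x⁻¹ : (Module.End F V)ˣ) : Module.End F V) ((x : Module.End F V) v) = v := by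
  rw [← Module.End.mul_apply, Units.inv_mul, Module.End.one_apply]

/-- The contribution to the Kloosterman sum of `a` of the automorphisms which stabilize an
`a`-stable subspace `U` and have a prescribed restriction to it. -/
theorem sum_block {F U V W : Type*} [Field F] [Finite F] [AddCommGroup U] [Module F U]
    [AddCommGroup V] [Module F V] [AddCommGroup W] [Module F W] [Finite U] [Finite V] [Finite W]
    [Fintype (Module.End F V)ˣ]
    (ψ : AddChar F ℂ) (i : U →ₗ[F] V) (π : V →ₗ[F] W)
    (hi : Function.Injective i) (hπ : Function.Surjective π)
    (hex : LinearMap.range i = LinearMap.ker π)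
    (a : Module.End F V) (aU : Module.End F U) (aW : Module.End F W)
    (haU : ∀ u, a (i u) = i (aU u)) (haW : ∀ v, π (a v) = aW (π v))
    (x₀ : (Module.End F U)ˣ) (p : (Module.End F V)ˣ → Prop) [DecidablePred p]
    (hp : ∀ x, p x ↔ ∀ u, (x : Module.End F V) (i u) = i ((x₀ : Module.End F U) u)) :
    ∑ x with p x, ψ (LinearMap.trace F V (a * x + (x⁻¹ : (Module.End F V)ˣ))) =
      (Nat.card F : ℂ) ^ (Module.finrank F W * Module.finrank F U) *
        (ψ (LinearMap.trace F U (aU * x₀ + (x₀⁻¹ : (Module.End F U)ˣ))) *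
          endKloosterman ψ aW) := by
  classical
  obtain ⟨ρ, σ, h1, h2, h3, h4, h5⟩ := exists_splitting i π hi hπ hex
  have : Finite (Module.End F W) := DFunLike.finite _
  have : Finite (W →ₗ[F] U) := DFunLike.finite _
  have := Fintype.ofFinite (Module.End F W)ˣ
  have := Fintype.ofFinite (W →ₗ[F] U)
  -- The block triangular automorphism with diagonal blocks `x₀`, `D` and corner `B`. The corner is
  -- free and does not affect the trace of `a x + x⁻¹`, whence the power of `q`.
  let blk : (Module.End F W)ˣ × (W →ₗ[F] U) → (Module.End F V)ˣ := fun z =>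
    { val := i ∘ₗ (x₀ : Module.End F U) ∘ₗ ρ + σ ∘ₗ (z.1 : Module.End F W) ∘ₗ π + i ∘ₗ z.2 ∘ₗ π
      inv := i ∘ₗ ((x₀⁻¹ : (Module.End F U)ˣ) : Module.End F U) ∘ₗ ρ
        + σ ∘ₗ ((z.1⁻¹ : (Module.End F W)ˣ) : Module.End F W) ∘ₗ π
        - i ∘ₗ ((x₀⁻¹ : (Module.End F U)ˣ) : Module.End F U) ∘ₗ z.2 ∘ₗ
          ((z.1⁻¹ : (Module.End F W)ˣ) : Module.End F W) ∘ₗ π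
      val_inv := by
        ext v
        simp [h1, h2, h3, h4, units_end_apply_inv]
        conv_rhs => rw [← h5 v]
        abel
      inv_val := by
        ext v
        simp [h1, h2, h3, h4, units_end_inv_apply]
        conv_rhs => rw [← h5 v]
        abel}
  have tr1 : ∀ (f : V →ₗ[F] U) (g : U →ₗ[F] V),
      LinearMap.trace F V (g ∘ₗ f) = LinearMap.trace F U (f ∘ₗ g) :=
    fun f g => LinearMap.trace_comp_comm' f g
  have tr2 : ∀ (f : V →ₗ[F] W) (g : W →ₗ[F] V),
      LinearMap.trace F V (g ∘ₗ f) = LinearMap.trace F W (f ∘ₗ g) :=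
    fun f g => LinearMap.trace_comp_comm' f g
  have trb : ∀ (b : Module.End F V) (A : Module.End F U) (D : Module.End F W) (B : W →ₗ[F] U),
      (∀ u, b (i u) = i (A u)) → (∀ w, b (σ w) = σ (D w) + i (B w)) →
      LinearMap.trace F V b = LinearMap.trace F U A + LinearMap.trace F W D := by
    intro b A D B hA hD
    have hb : b = (i ∘ₗ A) ∘ₗ ρ + (σ ∘ₗ D) ∘ₗ π + (i ∘ₗ B) ∘ₗ π := by
      ext v
      conv_lhs => rw [← h5 v]
      simp [hA, hD, add_assoc]
    have e1 : ρ ∘ₗ i ∘ₗ A = A := by ext; simp [h1]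
    have e2 : π ∘ₗ σ ∘ₗ D = D := by ext; simp [h2]
    have e3 : π ∘ₗ i ∘ₗ B = 0 := by ext; simp [h3]
    rw [hb, map_add, map_add, tr1, tr2, tr2, e1, e2, e3, map_zero, add_zero]
  have haσ : ∀ w, a (σ w) = σ (aW w) + i (ρ (a (σ w))) := fun w => by
    conv_lhs => rw [← h5 (a (σ w)), haW, h2]
    rw [add_comm]
  have hval : ∀ z, ψ (LinearMap.trace F V (a * blk z + ((blk z)⁻¹ : (Module.End F V)ˣ))) =
      ψ (LinearMap.trace F U (aU * x₀ + (x₀⁻¹ : (Module.End F U)ˣ))) *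
      ψ (LinearMap.trace F W (aW * z.1 + (z.1⁻¹ : (Module.End F W)ˣ))) := by
    intro z
    have t1 : LinearMap.trace F V (a * blk z) =
        LinearMap.trace F U (aU * x₀) + LinearMap.trace F W (aW * z.1) := by
      refine trb _ _ _ (ρ ∘ₗ a ∘ₗ σ ∘ₗ (z.1 : Module.End F W) + aU ∘ₗ z.2) ?_ ?_
      · intro u; simp [blk, h1, h3, haU]
      · intro w
        simp only [blk, Module.End.mul_apply, LinearMap.add_apply, LinearMap.comp_apply, h4, h2,
          map_zero, zero_add, map_add, haU]
        conv_lhs => rw [haσ]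
        abel
    have t2 : LinearMap.trace F V ((blk z)⁻¹ : (Module.End F V)ˣ) =
        LinearMap.trace F U ((x₀⁻¹ : (Module.End F U)ˣ)) +
          LinearMap.trace F W ((z.1⁻¹ : (Module.End F W)ˣ)) := by
      refine trb _ _ _ (- ((x₀⁻¹ : (Module.End F U)ˣ) : Module.End F U) ∘ₗ z.2 ∘ₗ
          ((z.1⁻¹ : (Module.End F W)ˣ) : Module.End F W)) ?_ ?_
      · intro u; simp [blk, h1, h3, Units.inv_mk]
      · intro w
        simp [blk, Units.inv_mk, h2, h4, sub_eq_add_neg]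
    rw [← AddChar.map_add_eq_mul, map_add, t1, t2, map_add (LinearMap.trace F U),
      map_add (LinearMap.trace F W)]
    congr 1
    abel
  have hcard : (Nat.card F : ℂ) ^ (Module.finrank F W * Module.finrank F U) =
      Fintype.card (W →ₗ[F] U) := by
    rw [← Nat.card_eq_fintype_card, Module.natCard_eq_pow_finrank (K := F) (V := W →ₗ[F] U),
      Module.finrank_linearMap]
    push_cast; rfl
  rw [hcard, endKloosterman_eq_sum]
  have hbij : ∑ x with p x, ψ (LinearMap.trace F V (a * x + (x⁻¹ : (Module.End F V)ˣ))) =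
      ∑ z : (Module.End F W)ˣ × (W →ₗ[F] U),
        ψ (LinearMap.trace F V (a * blk z + ((blk z)⁻¹ : (Module.End F V)ˣ))) := by
    symm
    refine Finset.sum_bij (fun z _ => blk z) ?_ ?_ ?_ (fun _ _ => rfl)
    · intro z _
      simp only [Finset.mem_filter, Finset.mem_univ, true_and, hp]
      intro u; simp [blk, h1, h3]
    · intro z _ z' _ h
      have h' : ∀ w, (blk z : Module.End F V) (σ w) = (blk z' : Module.End F V) (σ w) := by
        rw [h]; simp
      simp only [blk, LinearMap.add_apply, LinearMap.comp_apply, h4, h2, map_zero, zero_add] at h'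
      refine Prod.ext (Units.ext (LinearMap.ext fun w => ?_)) (LinearMap.ext fun w => ?_)
      · simpa [h2, h3] using congrArg π (h' w)
      · simpa [h1, h4] using congrArg ρ (h' w)
    · intro x hx
      simp only [Finset.mem_filter, Finset.mem_univ, true_and, hp] at hx
      have hx' : ∀ u, ((x⁻¹ : (Module.End F V)ˣ) : Module.End F V) (i u) =
          i (((x₀⁻¹ : (Module.End F U)ˣ) : Module.End F U) u) := by
        intro u
        conv_lhs => rw [← units_end_apply_inv x₀ u, ← hx, ← Module.End.mul_apply, Units.inv_mul]
        rfl
      -- Compression to the complement `σ W` respects this product because `x` preserves the image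
      -- of `i`; so the lower diagonal block of `x` is invertible.
      have key : ∀ (x y : (Module.End F V)ˣ), x * y = 1 →
          (∀ u, ∃ u', (x : Module.End F V) (i u) = i u') →
          (π ∘ₗ (x : Module.End F V) ∘ₗ σ) * (π ∘ₗ (y : Module.End F V) ∘ₗ σ) = 1 := by
        intro x y hxy hs
        ext w
        have e : (x : Module.End F V) ((y : Module.End F V) (σ w)) = σ w := by
          rw [← Module.End.mul_apply, ← Units.val_mul, hxy]; rfl
        obtain ⟨u', hu'⟩ := hs (ρ ((y : Module.End F V) (σ w)))
        rw [← h5 ((y : Module.End F V) (σ w)), map_add, hu'] at e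
        have := congrArg π e
        rw [map_add, h3, zero_add, h2] at this
        simpa using this
      refine ⟨(⟨_, _, key x x⁻¹ (mul_inv_cancel x) fun u => ⟨_, hx u⟩,
        key x⁻¹ x (inv_mul_cancel x) fun u => ⟨_, hx' u⟩⟩, ρ ∘ₗ (x : Module.End F V) ∘ₗ σ),
        Finset.mem_univ _, ?_⟩
      ext v
      simp only [blk, LinearMap.add_apply, LinearMap.comp_apply]
      conv_rhs => rw [← h5 v, map_add, hx, ← h5 ((x : Module.End F V) (σ (π v)))]
      abel
  rw [hbij, Finset.sum_congr rfl fun z _ => hval z, Fintype.sum_prod_type_right]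
  simp only [← Finset.mul_sum, Finset.sum_const, Finset.card_univ, nsmul_eq_mul]
  exact mul_left_comm _ _ _

/-! ### Averaging over transvections. -/

/-- Averaging over `g` replaces `f x` by `f x` times the mean of the character `χ x`, which vanishes
unless that character is trivial. The bijections `act g` need not form a group action. -/
theorem sum_eq_sum_filter_of_average {X G : Type*} [Fintype X] [AddGroup G] [Finite G]
    (f : X → ℂ) (act : G → X ≃ X) (χ : X → AddChar G ℂ) (p : X → Prop) [DecidablePred p]
    (hf : ∀ g x, f (act g x) = f x * χ x g) (hp : ∀ x, p x ↔ χ x = 1) :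
    ∑ x, f x = ∑ x with p x, f x := by
  classical
  have := Fintype.ofFinite G
  have h : (Fintype.card G : ℂ) * ∑ x, f x = (Fintype.card G : ℂ) * ∑ x with p x, f x := by
    calc (Fintype.card G : ℂ) * ∑ x, f x = ∑ g : G, ∑ x, f (act g x) := by
          simp_rw [fun g => Equiv.sum_comp (act g) f]
          simp
      _ = ∑ x, f x * ∑ g, χ x g := by
          rw [Finset.sum_comm]
          simp_rw [hf, Finset.mul_sum]
      _ = _ := by
          rw [Finset.mul_sum, Finset.sum_filter]
          refine Finset.sum_congr rfl fun x _ => ?_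
          by_cases hx : χ x = 1
          · simp [hp, hx, mul_comm]
          · rw [if_neg (by rwa [hp]), AddChar.sum_eq_zero_of_ne_one hx, mul_zero]
  exact mul_left_cancel₀ (Nat.cast_ne_zero.2 Fintype.card_ne_zero) h

theorem compAddMonoidHom_linear_eq_one_iff {F M : Type*} [Field F] [AddCommGroup M] [Module F M]
    {ψ : AddChar F ℂ} (hψ : ψ ≠ 1) (l : M →ₗ[F] F) :
    ψ.compAddMonoidHom l.toAddMonoidHom = 1 ↔ l = 0 := by
  constructor
  · intro h
    by_contra hl
    obtain ⟨m, hm⟩ : ∃ m, l m ≠ 0 := by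
      by_contra! hc
      exact hl (LinearMap.ext hc)
    refine hψ (DFunLike.ext _ _ fun s => ?_)
    have := DFunLike.congr_fun h ((s / l m) • m)
    simpa [hm] using this
  · rintro rfl
    ext m
    simp

/-- The transvection `v ↦ v + ξ v • e`, for a functional `ξ` which vanishes at `e`. -/
def unitTransvection {F V : Type*} [Field F] [AddCommGroup V] [Module F V] (e : V)
    (ξ : V →ₗ[F] F) (h : ξ e = 0) : (Module.End F V)ˣ where
  val := LinearMap.id + ξ.smulRight e
  inv := LinearMap.id - ξ.smulRight e
  val_inv := by ext v; simp [h]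
  inv_val := by ext v; simp [h]

theorem trace_smulRight {F V : Type*} [Field F] [AddCommGroup V] [Module F V]
    [FiniteDimensional F V] (ξ : V →ₗ[F] F) (v : V) :
    LinearMap.trace F V (ξ.smulRight v) = ξ v := by
  simp

/-- Averaging over transvections with centre an eigenvector `e` of `a`: only the automorphisms `x`
for which `α x e - x⁻¹ e` and `a x e - x⁻¹ e` are multiples of `e` contribute to the sum. -/
theorem endKloosterman_eq_sum_filter {F V V' : Type*} [Field F] [Finite F] [AddCommGroup V]
    [Module F V] [Finite V] [AddCommGroup V'] [Module F V'] [Finite V']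
    [Fintype (Module.End F V)ˣ]
    {ψ : AddChar F ℂ} (hψ : ψ ≠ 1) (a : Module.End F V) (α : F) (e : V) (hae : a e = α • e)
    (π : V →ₗ[F] V') (he : π e = 0)
    (p : (Module.End F V)ˣ → Prop) [DecidablePred p]
    (hp : ∀ x, p x ↔
      π (α • (x : Module.End F V) e - ((x⁻¹ : (Module.End F V)ˣ) : Module.End F V) e) = 0 ∧
      π (a ((x : Module.End F V) e) - ((x⁻¹ : (Module.End F V)ˣ) : Module.End F V) e) = 0) :
    endKloosterman ψ a =
      ∑ x with p x, ψ (LinearMap.trace F V (a * x + (x⁻¹ : (Module.End F V)ˣ))) := by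
  rw [endKloosterman_eq_sum]
  have : Finite (Module.Dual F V') := DFunLike.finite _
  let T : Module.Dual F V' → (Module.End F V)ˣ := fun ξ =>
    unitTransvection e (ξ ∘ₗ π) (by simp [he])
  refine sum_eq_sum_filter_of_average (G := Module.Dual F V' × Module.Dual F V') _
    (fun g => (Equiv.mulLeft (T g.1)).trans (Equiv.mulRight (T g.2)))
    (fun x => ψ.compAddMonoidHom (((Module.Dual.eval F V'
        (π (α • (x : Module.End F V) e - ((x⁻¹ : (Module.End F V)ˣ) : Module.End F V) e))).coprod
      (Module.Dual.eval F V'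
        (π (a ((x : Module.End F V) e) -
          ((x⁻¹ : (Module.End F V)ˣ) : Module.End F V) e))))).toAddMonoidHom) p ?_ ?_
  · rintro ⟨ξ, η⟩ x
    set y : Module.End F V := ((x⁻¹ : (Module.End F V)ˣ) : Module.End F V) with hy
    have e1 : ((Equiv.mulLeft (T ξ)).trans (Equiv.mulRight (T η)) x) = T ξ * x * T η := rfl
    have e2 : a * ((T ξ * x * T η : (Module.End F V)ˣ) : Module.End F V) =
        a * (x : Module.End F V) + (ξ ∘ₗ π ∘ₗ (x : Module.End F V)).smulRight (α • e) + (η ∘ₗ π).smulRight (a ((x : Module.End F V) e)) +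
          (η ∘ₗ π).smulRight (ξ (π ((x : Module.End F V) e)) • (α • e)) := by
      ext v
      simp [T, unitTransvection, hae, smul_smul, add_smul, add_assoc]
      module
    have e3 : (((T ξ * x * T η)⁻¹ : (Module.End F V)ˣ) : Module.End F V) =
        y - (η ∘ₗ π ∘ₗ y).smulRight e - (ξ ∘ₗ π).smulRight (y e) +
          (ξ ∘ₗ π).smulRight (η (π (y e)) • e) := by
      rw [mul_inv_rev, mul_inv_rev]
      ext v
      simp [T, unitTransvection, Units.inv_mk, hy, smul_smul, sub_smul]
      module
    simp only [e1]
    rw [e2, e3, AddChar.compAddMonoidHom_apply, ← AddChar.map_add_eq_mul]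
    congr 1
    -- Every correction has rank at most one. The terms bilinear in `ξ` and `η` are multiples of `e`
    -- paired with `η ∘ π` or `ξ ∘ π`, so they have trace zero, and the exponent is additive in `(ξ,
    -- η)`.
    simp only [map_add, map_sub, trace_smulRight, LinearMap.comp_apply, map_smul, he,
      LinearMap.toAddMonoidHom_coe, LinearMap.coprod_apply, LinearMap.sub_apply, LinearMap.smul_apply,
      Module.Dual.eval_apply, map_zero,
      smul_eq_mul]
    ring
  · intro x
    rw [compAddMonoidHom_linear_eq_one_iff hψ, hp]
    constructor
    · rintro ⟨h1, h2⟩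
      rw [h1, h2]
      ext <;> simp
    · intro h
      constructor
      · refine (Module.forall_dual_apply_eq_zero_iff F _).1 fun ξ => ?_
        simpa using LinearMap.congr_fun h (ξ, 0)
      · refine (Module.forall_dual_apply_eq_zero_iff F _).1 fun ξ => ?_
        simpa using LinearMap.congr_fun h (0, ξ)

/-! ### Stable lines, stable planes and the recursion. -/

theorem trace_algebraMap_self {F : Type*} [Field F] (c : F) :
    LinearMap.trace F F (algebraMap F (Module.End F F) c) = c := by
  rw [Algebra.algebraMap_eq_smul_one, map_smul, LinearMap.trace_one]
  simp

/-- The automorphisms which act on the eigenvector `e` of `a` by a scalar contribute a product of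
Kloosterman sums. -/
theorem sum_block_line {F V V' : Type*} [Field F] [Finite F] [AddCommGroup V]
    [Module F V] [Finite V] [AddCommGroup V'] [Module F V'] [Finite V']
    [Fintype (Module.End F V)ˣ]
    (ψ : AddChar F ℂ) (a : Module.End F V) (α : F) (e : V) (he : e ≠ 0) (hae : a e = α • e)
    (π : V →ₗ[F] V') (hπ : Function.Surjective π) (hker : LinearMap.ker π = F ∙ e)
    (a' : Module.End F V') (ha' : ∀ v, π (a v) = a' (π v)) (s : Fˣ)
    (p : (Module.End F V)ˣ → Prop) [DecidablePred p]
    (hp : ∀ x, p x ↔ (x : Module.End F V) e = (s : F) • e) :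
    ∑ x with p x, ψ (LinearMap.trace F V (a * x + (x⁻¹ : (Module.End F V)ˣ))) =
      (Nat.card F : ℂ) ^ (Module.finrank F V') *
        (ψ (α * s + (s⁻¹ : Fˣ)) * endKloosterman ψ a') := by
  have h := sum_block ψ (LinearMap.toSpanSingleton F V e) π
    (LinearMap.ker_eq_bot.1 (LinearMap.ker_toSpanSingleton F he)) hπ
    (by rw [hker, LinearMap.range_toSpanSingleton])
    a (algebraMap F (Module.End F F) α) a' (by simp [hae, smul_smul, mul_comm]) ha'
    (Units.map (algebraMap F (Module.End F F)).toMonoidHom s) p (fun x => by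
      rw [hp]
      constructor
      · intro h u
        simp [h, smul_smul, mul_comm]
      · intro h
        simpa using h 1)
  rw [h, Module.finrank_self, mul_one]
  congr 3
  rw [map_add]
  congr 1
  · rw [← trace_algebraMap_self (α * s), map_mul (algebraMap F (Module.End F F))]
    rfl
  · rw [← map_inv]
    exact trace_algebraMap_self _

/-- The automorphisms `x` with `x e = w` and `x w = α⁻¹ (e - c w)`. -/
theorem sum_block_plane {F V V' : Type*} [Field F] [Finite F] [AddCommGroup V]
    [Module F V] [Finite V] [AddCommGroup V'] [Module F V'] [Finite V']
    [Fintype (Module.End F V)ˣ]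
    (ψ : AddChar F ℂ) (a : Module.End F V) {α : F} (hα : α ≠ 0) (e w : V) (t c : F)
    (hew : LinearIndependent F ![e, w])
    (hae : a e = α • e) (haw : a w = α • w + t • e)
    (π : V →ₗ[F] V') (hπ : Function.Surjective π) (hker : LinearMap.ker π = Submodule.span F {e, w})
    (a' : Module.End F V') (ha' : ∀ v, π (a v) = a' (π v))
    (p : (Module.End F V)ˣ → Prop) [DecidablePred p]
    (hp : ∀ x, p x ↔ (x : Module.End F V) e = w ∧
      (x : Module.End F V) w = α⁻¹ • (e - c • w)) :
    ∑ x with p x, ψ (LinearMap.trace F V (a * x + (x⁻¹ : (Module.End F V)ˣ))) =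
      (Nat.card F : ℂ) ^ (Module.finrank F V' * 2) * (ψ t * endKloosterman ψ a') := by
  -- Matrices in the basis `e, w`; the inverse encodes `x⁻¹ e = α w + c e`.
  let x₀ : (Module.End F (Fin 2 → F))ˣ :=
    { val := Matrix.toLin' !![0, α⁻¹; 1, -(α⁻¹ * c)]
      inv := Matrix.toLin' !![c, 1; α, 0]
      val_inv := by
        rw [Module.End.mul_eq_comp, ← Matrix.toLin'_mul, Module.End.one_eq_id, ← Matrix.toLin'_one]
        congr 1
        ext i j
        fin_cases i <;> fin_cases j <;> simp [Matrix.mul_apply, hα] <;> field_simp <;> ring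
      inv_val := by
        rw [Module.End.mul_eq_comp, ← Matrix.toLin'_mul, Module.End.one_eq_id, ← Matrix.toLin'_one]
        congr 1
        ext i j
        fin_cases i <;> fin_cases j <;> simp [Matrix.mul_apply, hα] <;> field_simp <;> ring }
  have h := sum_block ψ (Fintype.linearCombination F ![e, w]) π
    hew.fintypeLinearCombination_injective hπ
    (by rw [hker, Fintype.range_linearCombination]; simp [Set.pair_comm])
    a (Matrix.toLin' !![α, t; 0, α]) a' (by
      intro u
      simp [Fintype.linearCombination_apply, Fin.sum_univ_two, Matrix.toLin'_apply,
        dotProduct, hae, haw]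
      module) ha'
    x₀ p (fun x => by
      rw [hp]
      constructor
      · rintro ⟨h1, h2⟩ u
        simp [x₀, Fintype.linearCombination_apply, Fin.sum_univ_two, Matrix.toLin'_apply,
          dotProduct, h1, h2]
        module
      · intro h
        have h0 := h (Pi.single 0 1)
        have h1 := h (Pi.single 1 1)
        simp [x₀, Fintype.linearCombination_apply, Fin.sum_univ_two, Matrix.toLin'_apply] at h0 h1
        refine ⟨h0, ?_⟩
        rw [h1]
        module)
  rw [h, Module.finrank_fin_fun]
  congr 3
  have e1 : Matrix.toLin' !![α, t; 0, α] * (x₀ : Module.End F (Fin 2 → F)) =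
      Matrix.toLin' (!![α, t; 0, α] * !![0, α⁻¹; 1, -(α⁻¹ * c)]) := (Matrix.toLin'_mul _ _).symm
  have e2 : ((x₀⁻¹ : (Module.End F (Fin 2 → F))ˣ) : Module.End F (Fin 2 → F)) =
      Matrix.toLin' !![c, 1; α, 0] := rfl
  -- The traces are `t - c` and `c`: the parameter `c` cancels.
  rw [map_add, e1, e2, Matrix.trace_toLin'_eq, Matrix.trace_toLin'_eq, Matrix.trace_fin_two,
    Matrix.trace_fin_two]
  simp [Matrix.mul_apply, Fin.sum_univ_two, hα]

/-- The recursion for the Kloosterman sum of `a` obtained from an eigenvector `e`: here `V'` is the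
quotient of `V` by the line through `e`, and `S w` is the Kloosterman sum of the endomorphism
induced by `a` on the quotient of `V'` by the line through the image of `w`. -/
theorem endKloosterman_rec {F V V' : Type*} [Field F] [Finite F] [AddCommGroup V]
    [Module F V] [Finite V] [AddCommGroup V'] [Module F V'] [Finite V'] [Fintype Fˣ] [Fintype V]
    {ψ : AddChar F ℂ} (hψ : ψ ≠ 1) (a : Module.End F V) {α : F} (hα : α ≠ 0)
    (e : V) (he : e ≠ 0) (hae : a e = α • e)
    (π : V →ₗ[F] V') (hπ : Function.Surjective π) (hker : LinearMap.ker π = F ∙ e)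
    (a' : Module.End F V') (ha' : ∀ v, π (a v) = a' (π v))
    (τ : V →ₗ[F] F) (hτ : τ e = 1) (S : V → ℂ)
    (hS : ∀ w, π w ≠ 0 → a' (π w) = α • π w →
      ∀ h' : (F ∙ π w) ≤ (F ∙ π w).comap a', endKloosterman ψ ((F ∙ π w).mapQ _ a' h') = S w)
    (p : V → Prop) [DecidablePred p] (hp : ∀ w, p w ↔ π w ≠ 0 ∧ a' (π w) = α • π w) :
    endKloosterman ψ a =
      (Nat.card F : ℂ) ^ (Module.finrank F V') * (∑ s : Fˣ, ψ (α * s + (s⁻¹ : Fˣ))) *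
        endKloosterman ψ a' +
      (Nat.card F : ℂ) ^ (2 * (Module.finrank F V' - 1) + 1) *
        ∑ w with p w, ψ (τ (a w - α • w)) * S w := by
  classical
  have : Finite (Module.End F V) := DFunLike.finite _
  have := Fintype.ofFinite (Module.End F V)ˣ
  have := Fintype.ofFinite F
  have hπe : π e = 0 := by
    have : e ∈ LinearMap.ker π := hker ▸ Submodule.mem_span_singleton_self e
    simpa using this
  have hmem : ∀ v, π v = 0 → v = τ v • e := by
    intro v hv
    have : v ∈ LinearMap.ker π := by simpa using hv
    rw [hker, Submodule.mem_span_singleton] at this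
    obtain ⟨c, rfl⟩ := this
    simp [hτ]
  rw [endKloosterman_eq_sum_filter hψ a α e hae π hπe _ (fun x => Iff.rfl),
    ← Finset.sum_fiberwise _ (fun x : (Module.End F V)ˣ => (x : Module.End F V) e),
    ← Finset.sum_filter_add_sum_filter_not Finset.univ (fun w => π w = 0)]
  congr 1
  · have h0 : ∀ g : V → ℂ, g 0 = 0 → ∑ w with π w = 0, g w = ∑ s : Fˣ, g ((s : F) • e) := by
      intro g hg
      rw [← Finset.sum_filter_ne_zero]
      symm
      refine Finset.sum_bij_ne_zero (fun s _ _ => (s : F) • e) ?_ ?_ ?_ (fun _ _ _ => rfl)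
      · intro s _ hs
        simp [hπe, hs]
      · intro s _ _ s' _ _ h
        exact Units.ext (smul_left_injective F he h)
      · intro w hw hw'
        simp only [Finset.mem_filter, Finset.mem_univ, true_and] at hw
        have hwe := hmem w hw.1
        have hτw : τ w ≠ 0 := by
          intro h
          rw [h, zero_smul] at hwe
          exact hw' (hwe ▸ hg)
        exact ⟨Units.mk0 _ hτw, Finset.mem_univ _, by simpa [← hwe] using hw', hwe.symm⟩
    rw [h0, mul_assoc, Finset.sum_mul, Finset.mul_sum]
    · refine Finset.sum_congr rfl fun s _ => ?_
      rw [Finset.filter_filter]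
      refine sum_block_line ψ a α e he hae π hπ hker a' ha' s _ fun x => ?_
      constructor
      · exact fun h => h.2
      · intro h
        have h2 : ((x⁻¹ : (Module.End F V)ˣ) : Module.End F V) e = ((s⁻¹ : Fˣ) : F) • e := by
          conv_lhs => rw [← inv_smul_smul s e, Units.smul_def, Units.smul_def s, map_smul, ← h,
            units_end_inv_apply]
        refine ⟨?_, h⟩
        rw [h2, h]
        simp [hπe, hae]
    · refine Finset.sum_eq_zero fun x hx => ?_
      simp only [Finset.mem_filter] at hx
      have := units_end_inv_apply x e
      rw [hx.2, map_zero] at this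
      exact absurd this.symm he
  · rw [Finset.mul_sum]
    symm
    have hsub : Finset.univ.filter p ⊆ Finset.univ.filter (fun w => ¬ π w = 0) := by
      intro w
      simp only [Finset.mem_filter, Finset.mem_univ, true_and, hp]
      exact fun h => h.1
    refine Finset.sum_subset_zero_on_sdiff hsub ?_ ?_
    · intro w hw
      simp only [Finset.mem_sdiff, Finset.mem_filter, Finset.mem_univ, true_and, hp, not_and] at hw
      refine Finset.sum_eq_zero fun x hx => ?_
      simp only [Finset.mem_filter, Finset.mem_univ, true_and, map_sub] at hx
      -- Both conditions equate something with the class of `x⁻¹ e`; comparing them makes `π (x e)`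
      -- an eigenvector of `a'`.
      obtain ⟨⟨h1, h2⟩, rfl⟩ := hx
      refine absurd ?_ (hw.2 hw.1)
      rw [← ha', sub_eq_zero.1 h2, ← sub_eq_zero.1 h1, map_smul]
    · intro w hw
      simp only [Finset.mem_filter, Finset.mem_univ, true_and, hp] at hw
      obtain ⟨hw0, hw1⟩ := hw
      have haw : a w = α • w + τ (a w - α • w) • e := by
        rw [← hmem (a w - α • w) (by rw [map_sub, map_smul, ha', hw1, sub_self])]
        abel
      have hst : (F ∙ π w) ≤ (F ∙ π w).comap a' := by
        rw [Submodule.span_singleton_le_iff_mem, Submodule.mem_comap, hw1]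
        exact Submodule.smul_mem _ _ (Submodule.mem_span_singleton_self _)
      have hrank : Module.finrank F (V' ⧸ (F ∙ π w)) = Module.finrank F V' - 1 := by
        have := Submodule.finrank_quotient_add_finrank (F ∙ π w)
        rw [finrank_span_singleton hw0] at this
        omega
      have hli : LinearIndependent F ![e, w] := by
        rw [LinearIndependent.pair_iff' he]
        rintro c rfl
        exact hw0 (by simp [hπe])
      -- Fibre over the coefficient `c` of `e` in `x⁻¹ e - α w`. All `q` fibres contribute equally,
      -- which accounts for the `+ 1` in the exponent of `q`.
      rw [Finset.filter_filter, ← Finset.sum_fiberwise _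
        (fun x : (Module.End F V)ˣ => τ (((x⁻¹ : (Module.End F V)ˣ) : Module.End F V) e - α • w))]
      have : Finite (V' ⧸ (F ∙ π w)) := Finite.of_surjective _ (Submodule.mkQ_surjective _)
      have hc : ∀ c : F, _ = _ := fun c =>
        sum_block_plane ψ a hα e w (τ (a w - α • w)) c hli hae haw
          ((F ∙ π w).mkQ ∘ₗ π) ((Submodule.mkQ_surjective _).comp hπ)
          (by
            rw [LinearMap.ker_comp, Submodule.ker_mkQ, ← Set.image_singleton, ← Submodule.map_span,
              Submodule.comap_map_eq, hker, ← Submodule.span_union, Set.union_comm]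
            rfl)
          ((F ∙ π w).mapQ _ a' hst) (fun v => by simp [ha']) _ (fun x => Iff.rfl)
      rw [hrank, hS w hw0 hw1] at hc
      rw [Finset.sum_congr rfl (fun c _ => (?_ : _ = _).trans (hc c)), Finset.sum_const,
        Finset.card_univ, ← Nat.card_eq_fintype_card, nsmul_eq_mul]
      · ring
      · rw [Finset.filter_filter]
        refine Finset.sum_congr (Finset.filter_congr fun x _ => ?_) fun _ _ => rfl
        constructor
        · rintro ⟨⟨⟨h1, h2⟩, h3⟩, h4⟩
          refine ⟨h3, ?_⟩
          rw [h3] at h1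
          have h5 := hmem (((x⁻¹ : (Module.End F V)ˣ) : Module.End F V) e - α • w)
            (by rw [← neg_sub, map_neg, h1, neg_zero])
          rw [h4, sub_eq_iff_eq_add] at h5
          have h6 := congrArg (x : Module.End F V) h5
          rw [units_end_apply_inv, map_add, map_smul, map_smul, h3] at h6
          rw [h6, add_sub_cancel_left, inv_smul_smul₀ hα]
        · rintro ⟨h3, h4⟩
          have h5 : ((x⁻¹ : (Module.End F V)ˣ) : Module.End F V) e = α • w + c • e := by
            have : e = (x : Module.End F V) (α • w + c • e) := by
              rw [map_add, map_smul, map_smul, h3, h4, smul_inv_smul₀ hα]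
              abel
            conv_lhs => rw [this, units_end_inv_apply]
          rw [h3, h5]
          refine ⟨⟨⟨?_, ?_⟩, rfl⟩, ?_⟩
          · simp [hπe]
          · rw [haw]; simp [hπe]
          · simp [hτ]

/-! ### Ranks on quotients, sums over layers and the universal polynomial. -/

/-- The image of the induced power is the projection of the image of `N ^ i`; it loses one dimension
exactly when that image contains the line being divided out. -/
theorem finrank_range_mapQ_pow {F V : Type*} [Field F] [AddCommGroup V] [Module F V]
    [FiniteDimensional F V] (N : Module.End F V) {e : V} (he : e ≠ 0)
    (h : (F ∙ e) ≤ (F ∙ e).comap N) (i : ℕ) (q : Prop) [Decidable q]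
    (hq : e ∈ LinearMap.range (N ^ i) ↔ q) :
    Module.finrank F (LinearMap.range ((F ∙ e).mapQ (F ∙ e) N h ^ i)) =
      Module.finrank F (LinearMap.range (N ^ i)) - if q then 1 else 0 := by
  rw [← Submodule.mapQ_pow]
  set R := LinearMap.range (N ^ i) with hR
  have hr : ∀ h', LinearMap.range ((F ∙ e).mapQ (F ∙ e) (N ^ i) h') =
      LinearMap.range ((F ∙ e).mkQ.domRestrict R) := by
    intro h'
    rw [LinearMap.range_domRestrict, hR, ← LinearMap.range_comp, ← Submodule.mapQ_mkQ (h := h'),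
      LinearMap.range_comp, Submodule.range_mkQ, LinearMap.range_eq_map]
  rw [hr]
  have hk := LinearMap.finrank_range_add_finrank_ker ((F ∙ e).mkQ.domRestrict R)
  have hk' : Module.finrank F (LinearMap.ker ((F ∙ e).mkQ.domRestrict R)) = if q then 1 else 0 := by
    split_ifs with hc
    · rw [← hq] at hc
      have : LinearMap.ker ((F ∙ e).mkQ.domRestrict R) = F ∙ (⟨e, hc⟩ : R) := by
        ext x
        simp [Submodule.mem_span_singleton, Subtype.ext_iff]
      rw [this, finrank_span_singleton]
      simpa using he
    · rw [← hq] at hc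
      have : LinearMap.ker ((F ∙ e).mkQ.domRestrict R) = ⊥ := by
        rw [LinearMap.ker_eq_bot']
        intro x hx
        simp only [LinearMap.domRestrict_apply, Submodule.mkQ_apply,
          Submodule.Quotient.mk_eq_zero, Submodule.mem_span_singleton] at hx
        obtain ⟨c, hcx⟩ := hx
        by_cases h0 : c = 0
        · rw [h0, zero_smul] at hcx
          exact Subtype.ext hcx.symm
        · refine absurd ?_ hc
          have : e = c⁻¹ • (x : V) := by rw [← hcx, inv_smul_smul₀ h0]
          rw [this]
          exact Submodule.smul_mem _ _ x.2
      rw [this, finrank_bot]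
  omega

theorem sum_addChar_submodule {F V : Type*} [Field F] [AddCommGroup V]
    [Module F V] [Fintype V] {ψ : AddChar F ℂ} (hψ : ψ ≠ 1) (A : Submodule F V)
    [DecidablePred (· ∈ A)] (l : V →ₗ[F] F) [Decidable (∀ w ∈ A, l w = 0)] :
    ∑ w with w ∈ A, ψ (l w) =
      if ∀ w ∈ A, l w = 0 then (Nat.card F : ℂ) ^ Module.finrank F A else 0 := by
  have h1 : ∑ w with w ∈ A, ψ (l w) =
      ∑ w : A, ψ.compAddMonoidHom (l ∘ₗ A.subtype).toAddMonoidHom w := by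
    rw [Finset.sum_subtype (Finset.univ.filter (· ∈ A)) (p := (· ∈ A)) (by simp)]
    rfl
  rw [h1]
  split_ifs with h
  · have h0 : l ∘ₗ A.subtype = 0 := LinearMap.ext fun w => h w w.2
    rw [(compAddMonoidHom_linear_eq_one_iff hψ _).2 h0]
    simp only [AddChar.one_apply, Finset.sum_const, nsmul_eq_mul, mul_one, Finset.card_univ]
    rw [← Nat.card_eq_fintype_card, Module.natCard_eq_pow_finrank (K := F) (V := A)]
    push_cast
    rfl
  · refine AddChar.sum_eq_zero_of_ne_one fun hc => h fun w hw => ?_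
    rw [compAddMonoidHom_linear_eq_one_iff hψ] at hc
    exact LinearMap.congr_fun hc ⟨w, hw⟩

/-- Summation over the layers of a decreasing sequence of subspaces. -/
theorem sum_layers {V : Type*} [Fintype V] (A : ℕ → V → Prop) [∀ h, DecidablePred (A h)]
    (hA : ∀ h w, A (h + 1) w → A h w) (k : ℕ) (p : V → Prop) [DecidablePred p]
    (hp : ∀ w, p w ↔ A 0 w ∧ ¬ A k w) (g : V → ℂ) (s : ℕ → ℂ) (S : V → ℂ)
    (hS : ∀ h < k, ∀ w, A h w → ¬ A (h + 1) w → S w = s h) :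
    ∑ w with p w, g w * S w =
      ∑ h ∈ Finset.range k, (∑ w with A h w, g w - ∑ w with A (h + 1) w, g w) * s h := by
  induction k generalizing p with
  | zero =>
    simp only [Finset.range_zero, Finset.sum_empty]
    refine Finset.sum_eq_zero fun w hw => ?_
    simp only [Finset.mem_filter, hp] at hw
    exact absurd hw.2.1 hw.2.2
  | succ k ih =>
    classical
    have h0 : ∀ w, A k w → A 0 w := by
      clear ih hp hS
      induction k with
      | zero => exact fun w h => h
      | succ k ih => exact fun w h => ih w (hA k w h)
    rw [Finset.sum_range_succ, ← ih (fun w => A 0 w ∧ ¬ A k w) (fun _ => Iff.rfl)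
      (fun h hh => hS h (by omega))]
    have h1 : ∑ w with A k w, g w - ∑ w with A (k + 1) w, g w =
        ∑ w with A k w ∧ ¬ A (k + 1) w, g w := by
      rw [sub_eq_iff_eq_add, ← Finset.sum_filter_add_sum_filter_not _ (A (k + 1)),
        Finset.filter_filter, Finset.filter_filter, add_comm]
      congr 2
      exact Finset.filter_congr fun w _ => ⟨fun h => h.2, fun h => ⟨hA k w h, h⟩⟩
    rw [h1, Finset.sum_mul, ← Finset.sum_filter_add_sum_filter_not _ (fun w => A k w),
      Finset.filter_filter, Finset.filter_filter, add_comm]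
    congr 1
    · refine Finset.sum_congr (Finset.filter_congr fun w _ => ?_) fun _ _ => rfl
      rw [hp]
      exact ⟨fun h => ⟨h.1.1, h.2⟩, fun h => ⟨⟨h.1, fun h' => h.2 (hA k w h')⟩, h.2⟩⟩
    · refine Finset.sum_congr (Finset.filter_congr fun w _ => ?_) fun w hw => ?_
      · rw [hp]
        exact ⟨fun h => ⟨h.2, h.1.2⟩, fun h => ⟨⟨h0 w h.1, h.2⟩, h.1⟩⟩
      · simp only [Finset.mem_filter, Finset.mem_univ, true_and] at hw
        rw [hS k (by omega) w hw.1 hw.2]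

open scoped Classical in
/-- The Kloosterman sum of `a` is given by a universal polynomial which depends only on the ranks
of the powers of the nilpotent endomorphism `a - α`. -/
theorem exists_polynomial_endKloosterman.{u} (n : ℕ) (f : ℕ → ℕ) :
    ∃ P : MvPolynomial (Fin 3) ℤ,
      ∀ (F : Type u) [Field F] [Fintype F] (ψ : AddChar F ℂ) (_ : ψ ≠ 1) (α : F) (_ : α ≠ 0)
        (V : Type u) [AddCommGroup V] [Module F V] [Finite V] (a : Module.End F V),
        Module.finrank F V = n →
        (∀ i, Module.finrank F (LinearMap.range ((a - algebraMap F _ α) ^ i)) = f i) →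
        (∃ k, f k = 0) →
        endKloosterman ψ a =
          MvPolynomial.aeval
            ![(Nat.card F : ℂ), (Nat.card F : ℂ) - 1, ∑ s : Fˣ, ψ (α * s + (s⁻¹ : Fˣ))] P := by
  induction n using Nat.strong_induction_on generalizing f with
  | _ n ih =>
  rcases Nat.eq_zero_or_pos n with rfl | hn
  · refine ⟨1, ?_⟩
    intro F _ _ ψ hψ α hα V _ _ _ a hV _ _
    have : Subsingleton V := Module.finrank_zero_iff.1 hV
    have : Unique (Module.End F V)ˣ :=
      { default := 1, uniq := fun x => Units.ext (LinearMap.ext fun v => Subsingleton.elim _ _) }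
    have hz : ∀ b : Module.End F V, b = 0 := fun b => LinearMap.ext fun v => Subsingleton.elim _ _
    rw [endKloosterman_eq_sum, Fintype.sum_unique, hz (_ + _)]
    simp
  by_cases hk : ∃ k, f k = 0
  swap
  · exact ⟨0, fun F _ _ ψ hψ α hα V _ _ _ a _ _ h => absurd h hk⟩
  obtain ⟨k, hk0, hkm⟩ : ∃ k, f k = 0 ∧ ∀ i < k, f i ≠ 0 :=
    ⟨Nat.find hk, Nat.find_spec hk, fun i hi => Nat.find_min hk hi⟩
  -- Ranks after dividing by `e`, which lies in the image of `N ^ i` exactly for `i < k`. Dividing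
  -- next by an eigenvector of depth exactly `h` lowers the ranks with `i ≤ h`.
  let f' : ℕ → ℕ := fun i => f i - if i < k then 1 else 0
  obtain ⟨P', hP'⟩ := ih (n - 1) (by omega) f'
  have hPs : ∀ h : ℕ, ∃ P : MvPolynomial (Fin 3) ℤ, 2 ≤ n → _ := fun h =>
    if hn2 : 2 ≤ n then
      (ih (n - 2) (by omega) (fun i => f' i - if i ≤ h then 1 else 0)).imp fun _ hP _ => hP
    else ⟨0, fun h => absurd h hn2⟩
  choose Ps hPs using hPs
  let X0 : MvPolynomial (Fin 3) ℤ := MvPolynomial.X 0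
  -- The value of the character sum over the subspace `A h` defined below, for `h ≤ k`.
  let Q : ℕ → MvPolynomial (Fin 3) ℤ := fun h =>
    if h + 1 < k then 0 else if h + 1 = k then X0 ^ f h else X0
  refine ⟨X0 ^ (n - 1) * MvPolynomial.X 2 * P' +
    X0 ^ (2 * (n - 1 - 1) + 1) * ∑ h ∈ Finset.range k, (Q h - Q (h + 1)) * Ps h, ?_⟩
  intro F _ _ ψ hψ α hα V _ _ _ a hV hf _
  have := Fintype.ofFinite V
  set N : Module.End F V := a - algebraMap F _ α with hN
  have haN : ∀ v, a v = α • v + N v := fun v => by simp [hN, Module.algebraMap_end_apply]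
  have hNk : ∀ i, k ≤ i → N ^ i = 0 := by
    intro i hi
    have : N ^ k = 0 := by
      rw [← LinearMap.range_eq_bot, ← Submodule.finrank_eq_zero (R := F), hf, hk0]
    rw [← Nat.sub_add_cancel hi, pow_add, this, mul_zero]
  have hkpos : 0 < k := by
    rcases Nat.eq_zero_or_pos k with rfl | h
    · have h1 := hf 0
      rw [hk0, pow_zero, Module.End.one_eq_id, LinearMap.range_id, finrank_top] at h1
      omega
    · exact h
  obtain ⟨m, rfl⟩ : ∃ m, k = m + 1 := ⟨k - 1, by omega⟩
  obtain ⟨v₀, hv₀⟩ : ∃ v₀, (N ^ m) v₀ ≠ 0 := by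
    by_contra! hc
    refine hkm m (by omega) ?_
    rw [← hf, LinearMap.range_eq_bot.2 (LinearMap.ext hc), finrank_bot]
  set e := (N ^ m) v₀ with he
  have hNe : N e = 0 := by
    rw [he, ← Module.End.mul_apply, ← pow_succ', hNk _ le_rfl, LinearMap.zero_apply]
  have hae : a e = α • e := by rw [haN, hNe, add_zero]
  have heR : ∀ i, e ∈ LinearMap.range (N ^ i) ↔ i < m + 1 := by
    intro i
    constructor
    · intro h
      by_contra! hc
      rw [hNk i hc] at h
      exact hv₀ (by simpa using h)
    · intro h
      refine ⟨(N ^ (m - i)) v₀, ?_⟩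
      rw [← Module.End.mul_apply, ← pow_add, Nat.add_sub_cancel' (by omega)]
  have hLN : (F ∙ e) ≤ (F ∙ e).comap N := by
    rw [Submodule.span_singleton_le_iff_mem, Submodule.mem_comap, hNe]
    exact Submodule.zero_mem _
  have hLa : (F ∙ e) ≤ (F ∙ e).comap a := by
    rw [Submodule.span_singleton_le_iff_mem, Submodule.mem_comap, hae]
    exact Submodule.smul_mem _ _ (Submodule.mem_span_singleton_self _)
  obtain ⟨τ, hτ⟩ : ∃ τ : V →ₗ[F] F, τ e = 1 := by
    obtain ⟨τ, hτ⟩ := LinearMap.exists_leftInverse_of_injective (LinearMap.toSpanSingleton F V e)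
      (LinearMap.ker_toSpanSingleton F hv₀)
    exact ⟨τ, by simpa using LinearMap.congr_fun hτ 1⟩
  set π := (F ∙ e).mkQ with hπ
  set a' := (F ∙ e).mapQ (F ∙ e) a hLa with ha'
  set N' := (F ∙ e).mapQ (F ∙ e) N hLN with hN'
  have : Finite (V ⧸ (F ∙ e)) := Finite.of_surjective _ (Submodule.mkQ_surjective _)
  have haN' : a' - algebraMap F _ α = N' := by
    refine LinearMap.ext fun w => ?_
    obtain ⟨v, rfl⟩ := Submodule.mkQ_surjective _ w
    simp [ha', hN', haN, Module.algebraMap_end_apply]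
  have haN'' : ∀ w, a' w = α • w + N' w := fun w => by
    rw [← haN']; simp [Module.algebraMap_end_apply]
  have hN'π : ∀ i v, (N' ^ i) (π v) = π ((N ^ i) v) := by
    intro i v
    rw [hN', ← Submodule.mapQ_pow]
    rfl
  have hf' : ∀ i, Module.finrank F (LinearMap.range (N' ^ i)) = f' i := by
    intro i
    rw [hN', finrank_range_mapQ_pow N hv₀ hLN i _ (heR i), hf]
  have hV' : Module.finrank F (V ⧸ (F ∙ e)) = n - 1 := by
    have := Submodule.finrank_quotient_add_finrank (F ∙ e)
    rw [finrank_span_singleton hv₀] at this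
    omega
  have hf'0 : ∃ k, f' k = 0 := ⟨m + 1, by simp [f', hk0]⟩
  have hS' : endKloosterman ψ a' = _ :=
    hP' F ψ hψ α hα (V ⧸ (F ∙ e)) a' hV' (by rw [haN']; exact hf') hf'0
  -- Vectors whose class modulo `e` is killed by `N'` and has depth at least `h`; `A (m + 1)` is the
  -- line through `e`.
  let A : ℕ → Submodule F V := fun h =>
    (LinearMap.range (N' ^ h) ⊓ LinearMap.ker N').comap π
  have hAmem : ∀ h w, w ∈ A h ↔ π w ∈ LinearMap.range (N' ^ h) ∧ N' (π w) = 0 := fun h w => by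
    simp only [A, Submodule.mem_comap, Submodule.mem_inf, LinearMap.mem_ker]
  have hanti : ∀ i j, i ≤ j → LinearMap.range (N' ^ j) ≤ LinearMap.range (N' ^ i) := by
    rintro i j hij _ ⟨v, rfl⟩
    refine ⟨(N' ^ (j - i)) v, ?_⟩
    rw [← Module.End.mul_apply, ← pow_add, Nat.add_sub_cancel' hij]
  have hN'k : ∀ i, m + 1 ≤ i → N' ^ i = 0 := by
    intro i hi
    refine LinearMap.ext fun w => ?_
    obtain ⟨v, rfl⟩ := Submodule.mkQ_surjective _ w
    rw [hN'π, hNk i hi]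
    simp
  have hker : ∀ w, π w = 0 ↔ w ∈ (F ∙ e) := fun w => by simp [hπ]
  let S : V → ℂ := fun w =>
    if h' : (F ∙ π w) ≤ (F ∙ π w).comap a' then endKloosterman ψ ((F ∙ π w).mapQ _ a' h') else 0
  set z : Fin 3 → ℂ :=
    ![(Nat.card F : ℂ), (Nat.card F : ℂ) - 1, ∑ s : Fˣ, ψ (α * s + (s⁻¹ : Fˣ))] with hz
  have hSlayer : ∀ h < m + 1, ∀ w, w ∈ A h → w ∉ A (h + 1) → S w = MvPolynomial.aeval z (Ps h) := by
    intro h hh w hw hw'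
    rw [hAmem] at hw hw'
    have hw0 : π w ≠ 0 := by
      intro h0
      rw [h0] at hw'
      exact hw' ⟨Submodule.zero_mem _, map_zero _⟩
    have hst : (F ∙ π w) ≤ (F ∙ π w).comap a' := by
      rw [Submodule.span_singleton_le_iff_mem, Submodule.mem_comap, haN'', hw.2, add_zero]
      exact Submodule.smul_mem _ _ (Submodule.mem_span_singleton_self _)
    have hstN : (F ∙ π w) ≤ (F ∙ π w).comap N' := by
      rw [Submodule.span_singleton_le_iff_mem, Submodule.mem_comap, hw.2]
      exact Submodule.zero_mem _
    have hn2 := Submodule.finrank_quotient_add_finrank (F ∙ π w)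
    rw [finrank_span_singleton hw0, hV'] at hn2
    have : Finite ((V ⧸ (F ∙ e)) ⧸ (F ∙ π w)) := Finite.of_surjective _ (Submodule.mkQ_surjective _)
    simp only [S, dif_pos hst]
    refine hPs h (by omega) F ψ hψ α hα _ _ (by omega) ?_ ?_
    · intro i
      have : (F ∙ π w).mapQ (F ∙ π w) a' hst - algebraMap F _ α =
          (F ∙ π w).mapQ (F ∙ π w) N' hstN := by
        refine LinearMap.ext fun x => ?_
        obtain ⟨v, rfl⟩ := Submodule.mkQ_surjective _ x
        simp [haN'', Module.algebraMap_end_apply]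
      rw [this, finrank_range_mapQ_pow N' hw0 hstN i (i ≤ h), hf']
      constructor
      · intro hi
        by_contra! hc
        exact hw' ⟨hanti (h + 1) i hc hi, hw.2⟩
      · exact fun hi => hanti i h hi hw.1
    · obtain ⟨j, hj⟩ := hf'0
      exact ⟨j, by simp [hj]⟩
  have hp : ∀ w, w ∈ A 0 ∧ w ∉ A (m + 1) ↔ π w ≠ 0 ∧ a' (π w) = α • π w := by
    intro w
    rw [hAmem, hAmem, hN'k (m + 1) le_rfl, haN'', add_eq_left]
    simp only [pow_zero, Module.End.one_eq_id, LinearMap.range_id, Submodule.mem_top, true_and,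
      LinearMap.range_zero, Submodule.mem_bot]
    tauto
  have hT : ∀ h < m + 2, ∑ w with w ∈ A h, ψ (τ (a w - α • w)) = MvPolynomial.aeval z (Q h) := by
    intro h hh
    have := sum_addChar_submodule hψ (A h) (τ ∘ₗ N)
    have hNw : ∀ w, a w - α • w = N w := fun w => by rw [haN]; abel
    simp only [hNw]
    refine this.trans ?_
    simp only [Q]
    rcases lt_trichotomy h m with hlt | rfl | hgt
    -- For `h < m` the vector `N ^ (m - 1) v₀` lies in `A h` and `N` sends it to `e`, where `τ` is
    -- `1`; the character is nontrivial and the sum vanishes.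
    · have hneg : ¬ ∀ w ∈ A h, (τ ∘ₗ N) w = 0 := by
        intro hc
        have h1 : N ((N ^ (m - 1)) v₀) = e := by
          rw [he, ← Module.End.mul_apply, ← pow_succ', Nat.sub_add_cancel (by omega)]
        have h2 := hc ((N ^ (m - 1)) v₀) (by
          rw [hAmem]
          constructor
          · refine ⟨π ((N ^ (m - 1 - h)) v₀), ?_⟩
            rw [hN'π, ← Module.End.mul_apply, ← pow_add, Nat.add_sub_cancel' (by omega)]
          · have := hN'π 1 ((N ^ (m - 1)) v₀)
            rw [pow_one, pow_one, h1] at this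
            rw [this, hker]
            exact Submodule.mem_span_singleton_self e)
        rw [LinearMap.comp_apply, h1, hτ] at h2
        exact one_ne_zero h2
      rw [if_neg hneg, if_pos (by omega), map_zero]
    -- Here `h = m`: the image of `N ^ m` contains `e`, so it is the full preimage of its
    -- projection, and `N` kills it. The sum is therefore `q ^ f m`.
    · have hA : A h = LinearMap.range (N ^ h) := by
        ext w
        rw [hAmem]
        constructor
        · rintro ⟨⟨x, hx⟩, -⟩
          obtain ⟨v, rfl⟩ := Submodule.mkQ_surjective _ x
          rw [hN'π, ← sub_eq_zero, ← map_sub, hker] at hx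
          have hle : (F ∙ e) ≤ LinearMap.range (N ^ h) := by
            rw [Submodule.span_singleton_le_iff_mem, heR]
            omega
          have h3 := Submodule.sub_mem _ (LinearMap.mem_range_self (N ^ h) v) (hle hx)
          rwa [sub_sub_cancel] at h3
        · rintro ⟨v, rfl⟩
          refine ⟨⟨π v, hN'π _ _⟩, ?_⟩
          have := hN'π 1 ((N ^ h) v)
          rw [pow_one, pow_one, ← Module.End.mul_apply, ← pow_succ', hNk _ le_rfl] at this
          simpa using this
      have hpos : ∀ w ∈ A h, (τ ∘ₗ N) w = 0 := by
        rw [hA]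
        rintro _ ⟨v, rfl⟩
        rw [LinearMap.comp_apply, ← Module.End.mul_apply, ← pow_succ', hNk _ le_rfl]
        simp
      rw [if_pos hpos, if_neg (by omega), if_pos rfl, hA, hf]
      simp [X0, hz]
    · obtain rfl : h = m + 1 := by omega
      have hA : A (m + 1) = (F ∙ e) := by
        ext w
        rw [hAmem, hN'k _ le_rfl, ← hker]
        simp only [LinearMap.range_zero, Submodule.mem_bot]
        exact ⟨fun h => h.1, fun h => ⟨h, by rw [h, map_zero]⟩⟩
      have hpos : ∀ w ∈ A (m + 1), (τ ∘ₗ N) w = 0 := by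
        rw [hA]
        intro w hw
        obtain ⟨c, rfl⟩ := Submodule.mem_span_singleton.1 hw
        simp [hNe]
      rw [if_pos hpos, if_neg (by omega), if_neg (by omega), hA, finrank_span_singleton hv₀]
      simp [X0, hz]
  rw [endKloosterman_rec hψ a hα e hv₀ hae π (Submodule.mkQ_surjective _) (Submodule.ker_mkQ _) a'
    (fun v => rfl) τ hτ S (fun w _ _ h' => by simp only [S, dif_pos h']) (fun w => w ∈ A 0 ∧ w ∉ A (m + 1)) hp,
    sum_layers (fun h w => w ∈ A h)
      (fun h w hw => by
        rw [hAmem] at hw ⊢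
        exact ⟨hanti h (h + 1) (by omega) hw.1, hw.2⟩) (m + 1)
      (fun w => w ∈ A 0 ∧ w ∉ A (m + 1)) (fun _ => Iff.rfl) _
      (fun h => MvPolynomial.aeval z (Ps h)) S hSlayer, hV', hS']
  simp only [map_add, map_mul, map_pow, map_sum, X0, MvPolynomial.aeval_X]
  congr 1
  congr 1
  refine Finset.sum_congr rfl fun h hh => ?_
  rw [Finset.mem_range] at hh
  rw [hT h (by omega), hT (h + 1) (by omega), map_sub]

/-! ### Ranks of powers from the Jordan form. -/

theorem jordanBlock_zero_apply {F : Type*} [Field F] (m : ℕ) (r c : Fin m) :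
    jordanBlock m (0 : F) r c = if (r : ℕ) + 1 = c then 1 else 0 := by
  by_cases h : r = c
  · simp [jordanBlock, h]
  · simp [jordanBlock, h]

theorem jordanBlock_zero_pow_apply {F : Type*} [Field F] (m k : ℕ) (r c : Fin m) :
    (jordanBlock m (0 : F) ^ k) r c = if (r : ℕ) + k = c then 1 else 0 := by
  induction k generalizing r with
  | zero => simp [Matrix.one_apply, Fin.ext_iff]
  | succ k ih =>
    rw [pow_succ', Matrix.mul_apply]
    simp only [ih, jordanBlock_zero_apply]
    by_cases h : (r : ℕ) + 1 < m
    · rw [Finset.sum_eq_single ⟨r + 1, h⟩]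
      · simp [add_assoc, add_comm 1 k]
      · intro b _ hb
        have : (r : ℕ) + 1 ≠ b := fun h' => hb (Fin.ext h'.symm)
        simp [this]
      · simp
    · rw [Finset.sum_eq_zero, if_neg (by omega)]
      intro b _
      have : (r : ℕ) + 1 ≠ b := by omega
      simp [this]

theorem jordanBlock_sub_algebraMap {F : Type*} [Field F] (m : ℕ) (β : F) :
    jordanBlock m β - algebraMap F _ β = jordanBlock m (0 : F) := by
  ext i j
  simp only [jordanBlock, Matrix.sub_apply, Matrix.of_apply, Matrix.algebraMap_matrix_apply]
  split_ifs <;> simp_all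

theorem jordanBlock_zero_pow_mul_transpose {F : Type*} [Field F] (m k : ℕ) :
    jordanBlock m (0 : F) ^ k * (jordanBlock m (0 : F) ^ k).transpose =
      Matrix.diagonal fun r : Fin m => if (r : ℕ) + k < m then (1 : F) else 0 := by
  ext r r'
  rw [Matrix.mul_apply, Matrix.diagonal_apply]
  simp only [Matrix.transpose_apply, jordanBlock_zero_pow_apply]
  by_cases h : (r : ℕ) + k < m
  · rw [Finset.sum_eq_single ⟨r + k, h⟩]
    · simp [h, Fin.ext_iff, eq_comm]
    · intro b _ hb
      have : (r : ℕ) + k ≠ b := fun h' => hb (Fin.ext h'.symm)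
      simp [this]
    · simp
  · rw [Finset.sum_eq_zero, if_neg h, ite_self]
    intro b _
    have : (r : ℕ) + k ≠ b := by omega
    simp [this]

theorem diagonal_mul_jordanBlock_zero_pow {F : Type*} [Field F] (m k : ℕ) :
    (Matrix.diagonal fun r : Fin m => if (r : ℕ) + k < m then (1 : F) else 0) *
      jordanBlock m (0 : F) ^ k = jordanBlock m (0 : F) ^ k := by
  ext r c
  rw [Matrix.diagonal_mul, jordanBlock_zero_pow_apply]
  split_ifs <;> first | omega | simp

/-- The power `M` satisfies `M Mᵀ M = M`, so it has the rank of `M Mᵀ`, a diagonal matrix of zeros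
and ones whose ones can be counted block by block. -/
theorem rank_blockDiagonal'_jordanBlock_zero_pow {F : Type*} [Field F] {l : ℕ} (d : Fin l → ℕ)
    (k : ℕ) :
    ((Matrix.blockDiagonal' fun i => jordanBlock (d i) (0 : F)) ^ k).rank = ∑ i, (d i - k) := by
  classical
  set M := (Matrix.blockDiagonal' fun i => jordanBlock (d i) (0 : F)) ^ k with hM
  have hM' : M = Matrix.blockDiagonal' fun i => jordanBlock (d i) (0 : F) ^ k := by
    rw [hM, ← Matrix.blockDiagonal'_pow]
    rfl
  have h1 : M * M.transpose =
      Matrix.diagonal fun x : Σ i, Fin (d i) => if (x.2 : ℕ) + k < d x.1 then (1 : F) else 0 := by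
    rw [hM', Matrix.blockDiagonal'_transpose, ← Matrix.blockDiagonal'_mul]
    simp only [jordanBlock_zero_pow_mul_transpose]
    exact Matrix.blockDiagonal'_diagonal fun i (r : Fin (d i)) =>
      if (r : ℕ) + k < d i then (1 : F) else 0
  have h2 : M * M.transpose * M = M := by
    rw [hM', Matrix.blockDiagonal'_transpose, ← Matrix.blockDiagonal'_mul,
      ← Matrix.blockDiagonal'_mul]
    simp only [jordanBlock_zero_pow_mul_transpose, diagonal_mul_jordanBlock_zero_pow]
  have h3 : M.rank = (M * M.transpose).rank := by
    refine le_antisymm ?_ (Matrix.rank_mul_le_left _ _)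
    conv_lhs => rw [← h2]
    exact Matrix.rank_mul_le_left _ _
  rw [h3, h1, Matrix.rank_diagonal, Fintype.card_subtype, Finset.card_filter, Fintype.sum_sigma]
  refine Finset.sum_congr rfl fun i _ => ?_
  simp only [ne_eq, ite_eq_right_iff, one_ne_zero, imp_false, not_not]
  rw [Fin.sum_univ_eq_sum_range (fun r => if r + k < d i then 1 else 0), ← Finset.card_filter]
  have : (Finset.range (d i)).filter (fun r => r + k < d i) = Finset.range (d i - k) := by
    ext r
    simp only [Finset.mem_filter, Finset.mem_range]
    omega
  rw [this, Finset.card_range]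

/-- The eigenvalues of the Jordan blocks of a matrix are eigenvalues of that matrix. -/
theorem eq_of_hasUniqueEigenvalue {F : Type*} [Field F] {n l : ℕ} {a : Matrix (Fin n) (Fin n) F}
    {α : F} (ha : HasUniqueEigenvalue a α) (d : Fin l → ℕ) (β : Fin l → F)
    (e : (Σ i : Fin l, Fin (d i)) ≃ Fin n) (g : Matrix.GeneralLinearGroup (Fin n) F)
    (h : (g : Matrix (Fin n) (Fin n) F) * a *
        ((g⁻¹ : Matrix.GeneralLinearGroup (Fin n) F) : Matrix (Fin n) (Fin n) F) =
      Matrix.reindex e e (Matrix.blockDiagonal' fun i => jordanBlock (d i) (β i)))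
    (i : Fin l) (hi : 0 < d i) : β i = α := by
  -- The first basis vector of block `i`, an eigenvector since ones stand only above the diagonal.
  set s : Fin n → F := Pi.single (e ⟨i, ⟨0, hi⟩⟩) 1 with hs
  set G : Matrix (Fin n) (Fin n) F :=
    ((g⁻¹ : Matrix.GeneralLinearGroup (Fin n) F) : Matrix (Fin n) (Fin n) F) with hG
  have hGg : G * (g : Matrix (Fin n) (Fin n) F) = 1 := Units.inv_mul g
  have hgG : (g : Matrix (Fin n) (Fin n) F) * G = 1 := Units.mul_inv g
  have h1 : Matrix.mulVec ((g : Matrix (Fin n) (Fin n) F) * a * G) s = β i • s := by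
    rw [h, hs, Matrix.mulVec_single_one]
    funext x
    obtain ⟨⟨j, r⟩, rfl⟩ := e.surjective x
    simp only [Matrix.col_apply, Matrix.reindex_apply, Matrix.submatrix_apply,
      Equiv.symm_apply_apply, Matrix.blockDiagonal'_apply, Pi.smul_apply, Pi.single_apply,
      EmbeddingLike.apply_eq_iff_eq]
    by_cases hj : j = i
    · subst hj
      simp [jordanBlock, Fin.ext_iff]
    · simp [hj]
  have h2 : Matrix.mulVec a (Matrix.mulVec G s) = β i • Matrix.mulVec G s := by
    rw [← Matrix.mulVec_smul, ← h1, Matrix.mulVec_mulVec, Matrix.mulVec_mulVec, ← mul_assoc,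
      ← mul_assoc, hGg, one_mul]
  have hv : Matrix.mulVec G s ≠ 0 := by
    intro h0
    have : s = 0 := by
      rw [← Matrix.one_mulVec s, ← hgG, ← Matrix.mulVec_mulVec, h0, Matrix.mulVec_zero]
    have h3 := congrFun this (e ⟨i, ⟨0, hi⟩⟩)
    simp [hs] at h3
  refine (algebraMap F (AlgebraicClosure F)).injective ((ha _).1 ?_)
  refine Module.End.hasEigenvalue_of_hasEigenvector
    (x := fun j => algebraMap F (AlgebraicClosure F) (Matrix.mulVec G s j)) ⟨?_, ?_⟩
  · rw [Module.End.mem_eigenspace_iff]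
    funext j
    have := congrArg (algebraMap F (AlgebraicClosure F)) (congrFun h2 j)
    rw [RingHom.map_mulVec] at this
    simpa [Matrix.toLin'_apply, Function.comp_def] using this
  · intro h0
    exact hv (funext fun j => (algebraMap F (AlgebraicClosure F)).injective
      (by simpa using congrFun h0 j))

/-- All parts are positive, so uniqueness of the eigenvalue forces every block to have eigenvalue
`α`; subtracting `α` then leaves nilpotent blocks. -/
theorem rank_sub_algebraMap_pow {F : Type*} [Field F] {n : ℕ} {a : Matrix (Fin n) (Fin n) F}
    {α : F} (ha : HasUniqueEigenvalue a α) {lam : Nat.Partition n} (hlam : HasJordanPartition a lam)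
    (k : ℕ) : ((a - algebraMap F _ α) ^ k).rank = (lam.parts.map (· - k)).sum := by
  obtain ⟨l, d, β, e, g, hd, h⟩ := hlam
  have hβ : ∀ i, β i = α := fun i =>
    eq_of_hasUniqueEigenvalue ha d β e g h i (lam.parts_pos (by
      rw [← hd]
      exact Multiset.mem_map_of_mem _ (Finset.mem_univ i)))
  set B := Matrix.blockDiagonal' fun i => jordanBlock (d i) (0 : F) with hB
  have hconj : (g : Matrix (Fin n) (Fin n) F) * (a - algebraMap F _ α) *
      ((g⁻¹ : Matrix.GeneralLinearGroup (Fin n) F) : Matrix (Fin n) (Fin n) F) =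
      Matrix.reindexAlgEquiv F F e B := by
    have hB' : B = (Matrix.blockDiagonal' fun i => jordanBlock (d i) (β i)) - algebraMap F _ α := by
      have : algebraMap F (Matrix (Σ i, Fin (d i)) (Σ i, Fin (d i)) F) α =
          Matrix.blockDiagonal' fun i => algebraMap F (Matrix (Fin (d i)) (Fin (d i)) F) α := by
        simp only [Matrix.algebraMap_eq_diagonal]
        rw [Matrix.blockDiagonal'_diagonal]
        rfl
      rw [this, ← Matrix.blockDiagonal'_sub, hB]
      congr 1
      funext i
      rw [Pi.sub_apply, hβ, jordanBlock_sub_algebraMap]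
    rw [hB', map_sub, AlgEquiv.commutes, Matrix.coe_reindexAlgEquiv, ← h, mul_sub, sub_mul,
      ← Algebra.commutes α, mul_assoc (algebraMap F _ α), Units.mul_inv, mul_one]
  have hpow : (g : Matrix (Fin n) (Fin n) F) * (a - algebraMap F _ α) ^ k *
      ((g⁻¹ : Matrix.GeneralLinearGroup (Fin n) F) : Matrix (Fin n) (Fin n) F) =
      Matrix.reindexAlgEquiv F F e (B ^ k) := by
    rw [map_pow, ← hconj, Units.conj_pow]
  have hrank := congrArg Matrix.rank hpow
  rw [Matrix.rank_mul_eq_left_of_isUnit_det _ _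
      ((Matrix.isUnit_iff_isUnit_det _).1 (Units.isUnit _)),
    Matrix.rank_mul_eq_right_of_isUnit_det _ _
      ((Matrix.isUnit_iff_isUnit_det _).1 (Units.isUnit _)),
    Matrix.coe_reindexAlgEquiv, Matrix.rank_reindex,
    rank_blockDiagonal'_jordanBlock_zero_pow] at hrank
  rw [hrank, ← hd, Multiset.map_map]
  rfl

/-! ### The standard character and the return to matrices. -/

/-- The trace to the prime field is surjective, so triviality would pass down to the primitive
character of `ZMod p`. -/
theorem stdChar_nontrivial (p : ℕ) [Fact p.Prime] (F : Type*) [Field F] [Finite F]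
    [Algebra (ZMod p) F] :
    (ZMod.stdAddChar (N := p)).compAddMonoidHom (Algebra.trace (ZMod p) F).toAddMonoidHom ≠ 1 := by
  intro h
  refine ZMod.isPrimitive_stdAddChar p one_ne_zero ?_
  rw [AddChar.mulShift_one]
  refine DFunLike.ext _ _ fun y => ?_
  obtain ⟨x, rfl⟩ := Algebra.trace_surjective (ZMod p) F y
  exact DFunLike.congr_fun h x

theorem matrixKloosterman_eq_endKloosterman (p : ℕ) [Fact p.Prime] {F : Type*} [Field F]
    [Fintype F] [DecidableEq F] [Algebra (ZMod p) F] {n : ℕ} (a : Matrix (Fin n) (Fin n) F) :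
    matrixKloosterman p a =
      endKloosterman ((ZMod.stdAddChar (N := p)).compAddMonoidHom
        (Algebra.trace (ZMod p) F).toAddMonoidHom) (Matrix.toLinAlgEquiv' a) := by
  have : Finite (Module.End F (Fin n → F)) := DFunLike.finite _
  have := Fintype.ofFinite (Module.End F (Fin n → F))ˣ
  rw [endKloosterman_eq_sum]
  refine Fintype.sum_equiv
    (Units.mapEquiv (Matrix.toLinAlgEquiv' (R := F) (n := Fin n)).toMulEquiv).toEquiv _ _ ?_
  intro x
  have h : Matrix.toLinAlgEquiv' a * ((Units.mapEquiv
      (Matrix.toLinAlgEquiv' (R := F) (n := Fin n)).toMulEquiv x : (Module.End F (Fin n → F))ˣ) :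
        Module.End F (Fin n → F)) +
      (((Units.mapEquiv (Matrix.toLinAlgEquiv' (R := F) (n := Fin n)).toMulEquiv x)⁻¹ :
        (Module.End F (Fin n → F))ˣ) : Module.End F (Fin n → F)) =
      Matrix.toLin' (a * (x : Matrix (Fin n) (Fin n) F) +
        ((x⁻¹ : Matrix.GeneralLinearGroup (Fin n) F) : Matrix (Fin n) (Fin n) F)) := by
    rw [← map_inv, map_add, Matrix.toLin'_mul]
    rfl
  refine Eq.trans ?_ (congrArg _ (congrArg _ h.symm))
  rw [Matrix.trace_toLin'_eq]
  rfl

theorem mainTheorem6 (n : ℕ) (lam : Nat.Partition n) :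
    ∃ P : MvPolynomial (Fin 3) ℤ,
      ∀ (p : ℕ) [Fact p.Prime] (F : Type*) [Field F] [Fintype F] [DecidableEq F]
        [Algebra (ZMod p) F] (a : Matrix.GeneralLinearGroup (Fin n) F) (α : F),
        α ≠ 0 →
        HasUniqueEigenvalue (a : Matrix (Fin n) (Fin n) F) α →
        HasJordanPartition (a : Matrix (Fin n) (Fin n) F) lam →
        matrixKloosterman p (a : Matrix (Fin n) (Fin n) F) =
          MvPolynomial.aeval
            ![(Fintype.card F : ℂ), (Fintype.card F : ℂ) - 1, kloosterman p α] P := by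
  obtain ⟨P, hP⟩ := exists_polynomial_endKloosterman n fun k => (lam.parts.map (· - k)).sum
  refine ⟨P, ?_⟩
  intro p _ F _ _ _ _ a α hα hu hlam
  rw [matrixKloosterman_eq_endKloosterman, hP F _ (stdChar_nontrivial p F) α hα (Fin n → F) _
    (Module.finrank_fin_fun F)]
  · rw [Nat.card_eq_fintype_card]
    congr!
    rw [kloosterman]
    congr!
  · intro k
    rw [← rank_sub_algebraMap_pow hu hlam k, Matrix.rank, ← Matrix.toLin'_apply',
      ← AlgEquiv.commutes (Matrix.toLinAlgEquiv' (R := F) (n := Fin n)), ← map_sub, ← map_pow]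
    rfl
  -- No part exceeds `n`, so the truncated differences vanish at `k = n`.
  · refine ⟨n, Multiset.sum_eq_zero fun x hx => ?_⟩
    obtain ⟨y, hy, rfl⟩ := Multiset.mem_map.1 hx
    have := Multiset.single_le_sum (fun _ _ => Nat.zero_le _) y hy
    rw [lam.parts_sum] at this
    omega
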